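/- **Theorem (First-order optimality condition).** Let $n\ge 1$ and let $\Omega\subset\mathbb{R}^n$ be a bounded open set (in particular, $\Omega$ may be a bounded convex domain in $\mathbb{R}^2$ or $\mathbb{R}^3$ with $C^{1,1}$ or polygonal boundary). Let $a_{ij},c_0\in L^\infty(\Omega)$ ($1\le i,j\le n$) with $c_0\ge 0$ and $a_{ij}=a_{ji}$ a.e. in $\Omega$, and suppose that there is $\theta>0$ with $\sum_{i,j}a_{ij}(x)\xi_i\xi_j\ge\theta\|\xi\|^2$ for almost all $x\in\Omega$ and all $\xi\in\mathbb{R}^n$. Let $H^1_0(\Omega)$ be the closure of $C_c^\infty(\Omega)$ in $H^1(\Omega)$, and for $y,v\in H^1_0(\Omega)$ put $$a(y,v)=\int_\Omega\Big(\sum_{i,j=1}^n a_{ij}\,\partial_{x_i}y\,\partial_{x_j}v+c_0\,y\,v\Big)\,dx .$$ Let $y_c,y_d\in L^2(\Omega)$, $-\infty<a<0<b<+\infty$, $\alpha,\beta>0$, and $U_{ad}=\{v\in L^2(\Omega): a\le v\le b \text{ a.e. on }\Omega\}$. Consider the problem $$(\widetilde{\mathrm P})\quad \min_{(y,u,z)\in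 H^1_0(\Omega)\times L^2(\Omega)\times L^2(\Omega)} \tfrac12\|y-y_d\|_{L^2(\Omega)}^2+\tfrac{\alpha}{4}\|u\|_{L^2(\Omega)}^2+\tfrac{\alpha}{4}\|z\|_{L^2(\Omega)}^2+\beta\|z\|_{L^1(\Omega)}$$ subject to $a(y,v)=(u+y_c,v)_{L^2(\Omega)}$ for all $v\in H^1_0(\Omega)$, $u=z$, and $z\in U_{ad}$. Then $(y^*,u^*,z^*)\in H^1_0(\Omega)\times L^2(\Omega)\times L^2(\Omega)$ is an optimal solution of $(\widetilde{\mathrm P})$ if and only if there exist an adjoint state $p^*\in H^1_0(\Omega)$ and a multiplier $\lambda^*\in L^2(\Omega)$ such that 1. $a(y^*,v)=(u^*+y_c,v)_{L^2(\Omega)}$ for all $v\in H^1_0(\Omega)$ (state equation); 2. $a(v,p^*)=(y_d-y^*,v)_{L^2(\Omega)}$ for all $v\in H^1_0(\Omega)$ (adjoint equation); 3. $\frac{\alpha}{2}u^*-p^*+\lambda^*=0$; 4. $u^*=z^*$; 5. $z^*\in U_{ad}$; 6. $\big\langle\frac{\alpha}{2}z^*-\lambda^*,\tilde z-z^*\big\rangle_{L^2(\Omega)}+\beta\big(\|\tilde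 z\|_{L^1(\Omega)}-\|z^*\|_{L^1(\Omega)}\big)\ge 0$ for all $\tilde z\in U_{ad}$. Moreover, whenever 1–6 hold, $$u^*(x)=\Pi_{U_{ad}}\Big(\tfrac1\alpha\,\mathrm{soft}(p^*(x),\beta)\Big)\quad\text{for a.e. }x\in\Omega,$$ where $\Pi_{U_{ad}}(t)=\max\{a,\min\{t,b\}\}$ and $\mathrm{soft}(t,\beta)=\mathrm{sgn}(t)\max(|t|-\beta,0)$. In addition, the optimal control has the regularity $u^*\in H^1(\Omega)$. -/

import Mathlib

noncomputable section

open MeasureTheory TopologicalSpace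
open scoped Distributions ENNReal

namespace SparseControl

/-- The Lebesgue measure on the open set `Ω ⊆ ℝⁿ`. -/
abbrev vol {n : ℕ} (Ω : Opens (EuclideanSpace ℝ (Fin n))) :
    Measure (EuclideanSpace ℝ (Fin n)) :=
  volume.restrict (Ω : Set (EuclideanSpace ℝ (Fin n)))

/-- `L²(Ω)`, real valued. -/
abbrev L2 {n : ℕ} (Ω : Opens (EuclideanSpace ℝ (Fin n))) : Type :=
  Lp ℝ 2 (vol Ω)

/-- Pairs of a function in `L²(Ω)` and a vector field in `L²(Ω)ⁿ`, with the Hilbert norm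
`(‖y‖² + ∑ᵢ ‖gᵢ‖²)^(1/2)`. -/
abbrev Jet {n : ℕ} (Ω : Opens (EuclideanSpace ℝ (Fin n))) : Type :=
  WithLp 2 (L2 Ω × PiLp 2 (fun _ : Fin n => L2 Ω))

/-- The classical partial derivative `∂φ/∂xᵢ` of a test function `φ ∈ C_c^∞(Ω)`. -/
def partialDeriv {n : ℕ} {Ω : Opens (EuclideanSpace ℝ (Fin n))} (φ : 𝓓(Ω, ℝ)) (i : Fin n)
    (x : EuclideanSpace ℝ (Fin n)) : ℝ :=
  fderiv ℝ φ x (EuclideanSpace.single i 1)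

theorem memLp_testFunction {n : ℕ} {Ω : Opens (EuclideanSpace ℝ (Fin n))} (φ : 𝓓(Ω, ℝ)) :
    MemLp φ 2 (vol Ω) :=
  (φ.continuous.memLp_of_hasCompactSupport φ.hasCompactSupport).restrict _

theorem memLp_partialDeriv {n : ℕ} {Ω : Opens (EuclideanSpace ℝ (Fin n))} (φ : 𝓓(Ω, ℝ))
    (i : Fin n) : MemLp (partialDeriv φ i) 2 (vol Ω) := by
  have hc : Continuous (partialDeriv φ i) :=
    (φ.contDiff.continuous_fderiv (by simp)).clm_apply continuous_const
  have hs : HasCompactSupport (partialDeriv φ i) :=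
    φ.hasCompactSupport.fderiv_apply (𝕜 := ℝ) _
  exact (hc.memLp_of_hasCompactSupport hs).restrict _

theorem integrable_mul_of_memLp {n : ℕ} {Ω : Opens (EuclideanSpace ℝ (Fin n))}
    {f g : EuclideanSpace ℝ (Fin n) → ℝ} (hf : MemLp f 2 (vol Ω)) (hg : MemLp g 2 (vol Ω)) :
    Integrable (fun x => f x * g x) (vol Ω) :=
  hf.integrable_mul hg

/-- `g` is the weak gradient of `y` on `Ω`:
`∫_Ω y ∂ᵢφ = - ∫_Ω gᵢ φ` for all `φ ∈ C_c^∞(Ω)` and all `i`. -/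
def IsWeakGradient {n : ℕ} {Ω : Opens (EuclideanSpace ℝ (Fin n))} (y : L2 Ω)
    (g : Fin n → L2 Ω) : Prop :=
  ∀ (φ : 𝓓(Ω, ℝ)) (i : Fin n),
    ∫ x, y x * partialDeriv φ i x ∂(vol Ω) = - ∫ x, g i x * φ x ∂(vol Ω)

/-- The Sobolev space `H¹(Ω)`. An element is stored together with its weak gradient, which is
uniquely determined (see `isWeakGradient_unique`); the norm inherited from `Jet Ω` is the
`H¹`-norm. -/
def H1 {n : ℕ} (Ω : Opens (EuclideanSpace ℝ (Fin n))) : Submodule ℝ (Jet Ω) where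
  carrier := {w | IsWeakGradient w.fst w.snd}
  add_mem' := by
    intro v w hv hw φ i
    have e1 : ∫ x, (v + w).fst x * partialDeriv φ i x ∂(vol Ω)
        = ∫ x, (v.fst x * partialDeriv φ i x + w.fst x * partialDeriv φ i x) ∂(vol Ω) := by
      refine integral_congr_ae ?_
      filter_upwards [Lp.coeFn_add v.fst w.fst] with x hx
      rw [WithLp.add_fst, hx, Pi.add_apply, add_mul]
    have e2 : ∫ x, (v + w).snd i x * φ x ∂(vol Ω)
        = ∫ x, (v.snd i x * φ x + w.snd i x * φ x) ∂(vol Ω) := by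
      refine integral_congr_ae ?_
      filter_upwards [Lp.coeFn_add (v.snd i) (w.snd i)] with x hx
      rw [WithLp.add_snd, PiLp.add_apply, hx, Pi.add_apply, add_mul]
    rw [e1, e2, integral_add (integrable_mul_of_memLp (Lp.memLp v.fst) (memLp_partialDeriv φ i))
        (integrable_mul_of_memLp (Lp.memLp w.fst) (memLp_partialDeriv φ i)),
      integral_add (integrable_mul_of_memLp (Lp.memLp (v.snd i)) (memLp_testFunction φ))
        (integrable_mul_of_memLp (Lp.memLp (w.snd i)) (memLp_testFunction φ)), hv φ i, hw φ i]
    ring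
  zero_mem' := by
    intro φ i
    have e1 : ∫ x, (0 : Jet Ω).fst x * partialDeriv φ i x ∂(vol Ω) = 0 := by
      refine integral_eq_zero_of_ae ?_
      filter_upwards [Lp.coeFn_zero ℝ 2 (vol Ω)] with x hx
      rw [WithLp.zero_fst, hx, Pi.zero_apply, zero_mul]
    have e2 : ∫ x, (0 : Jet Ω).snd i x * φ x ∂(vol Ω) = 0 := by
      refine integral_eq_zero_of_ae ?_
      filter_upwards [Lp.coeFn_zero ℝ 2 (vol Ω)] with x hx
      rw [WithLp.zero_snd, PiLp.zero_apply, hx, Pi.zero_apply, zero_mul]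
    rw [e1, e2, neg_zero]
  smul_mem' := by
    intro c w hw φ i
    have e1 : ∫ x, (c • w).fst x * partialDeriv φ i x ∂(vol Ω)
        = ∫ x, c * (w.fst x * partialDeriv φ i x) ∂(vol Ω) := by
      refine integral_congr_ae ?_
      filter_upwards [Lp.coeFn_smul c w.fst] with x hx
      rw [WithLp.smul_fst, hx, Pi.smul_apply, smul_eq_mul, mul_assoc]
    have e2 : ∫ x, (c • w).snd i x * φ x ∂(vol Ω)
        = ∫ x, c * (w.snd i x * φ x) ∂(vol Ω) := by
      refine integral_congr_ae ?_
      filter_upwards [Lp.coeFn_smul c (w.snd i)] with x hx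
      rw [WithLp.smul_snd, PiLp.smul_apply, hx, Pi.smul_apply, smul_eq_mul, mul_assoc]
    rw [e1, e2, integral_const_mul, integral_const_mul, hw φ i]
    ring

/-- Weak gradients are unique, so that the first component of an element of `H1 Ω`
determines the element. -/
theorem isWeakGradient_unique {n : ℕ} {Ω : Opens (EuclideanSpace ℝ (Fin n))} {y : L2 Ω}
    {g h : Fin n → L2 Ω} (hg : IsWeakGradient y g) (hh : IsWeakGradient y h) : g = h := by
  funext i
  have hint : ∀ f : L2 Ω, LocallyIntegrableOn f (Ω : Set (EuclideanSpace ℝ (Fin n))) volume :=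
    fun f => (locallyIntegrableOn_of_locallyIntegrable_restrict
      ((Lp.memLp f).locallyIntegrable (by norm_num)))
  have key : ∀ᵐ x ∂volume, x ∈ (Ω : Set (EuclideanSpace ℝ (Fin n))) → g i x - h i x = 0 := by
    refine Ω.isOpen.ae_eq_zero_of_integral_contDiff_smul_eq_zero
      (f := fun x => g i x - h i x) ((hint (g i)).sub (hint (h i))) ?_
    intro ψ hψ hψc hψs
    let φ : 𝓓(Ω, ℝ) := ⟨ψ, hψ, hψc, hψs⟩
    have h0 : ∫ x, g i x * φ x ∂(vol Ω) = ∫ x, h i x * φ x ∂(vol Ω) :=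
      neg_injective ((hg φ i).symm.trans (hh φ i))
    have h1 : ∫ x, ψ x • (g i x - h i x) ∂(vol Ω) = 0 := by
      have : ∀ x, ψ x • (g i x - h i x) = g i x * φ x - h i x * φ x := by
        intro x
        change ψ x * _ = g i x * ψ x - h i x * ψ x
        ring
      simp_rw [this]
      rw [integral_sub (integrable_mul_of_memLp (Lp.memLp (g i)) (memLp_testFunction φ))
        (integrable_mul_of_memLp (Lp.memLp (h i)) (memLp_testFunction φ)), h0, sub_self]
    rw [← h1]
    refine (setIntegral_eq_integral_of_forall_compl_eq_zero ?_).symm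
    intro x hx
    have : ψ x = 0 := image_eq_zero_of_notMem_tsupport (fun hx' => hx (hψs hx'))
    rw [this, zero_smul]
  refine Lp.ext ?_
  rw [Filter.EventuallyEq, ae_restrict_iff' Ω.isOpen.measurableSet]
  filter_upwards [key] with x hx hxΩ
  exact sub_eq_zero.mp (hx hxΩ)

/-- The element `(φ, ∇φ)` of `Jet Ω` given by a test function `φ ∈ C_c^∞(Ω)`. -/
def testJet {n : ℕ} {Ω : Opens (EuclideanSpace ℝ (Fin n))} (φ : 𝓓(Ω, ℝ)) : Jet Ω :=
  WithLp.toLp 2 ((memLp_testFunction φ).toLp φ,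
    WithLp.toLp 2 fun i => (memLp_partialDeriv φ i).toLp (partialDeriv φ i))

/-- The Sobolev space `H¹₀(Ω)`: the closure of `C_c^∞(Ω)` in `H¹(Ω)`. -/
def H10 {n : ℕ} (Ω : Opens (EuclideanSpace ℝ (Fin n))) : Submodule ℝ (Jet Ω) :=
  H1 Ω ⊓ (Submodule.span ℝ (Set.range (testJet (Ω := Ω)))).topologicalClosure

/-- The function in `L²(Ω)` underlying an element of `H¹₀(Ω)`. -/
def H10.val {n : ℕ} {Ω : Opens (EuclideanSpace ℝ (Fin n))} (y : H10 Ω) : L2 Ω :=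
  (y : Jet Ω).fst

/-- The weak partial derivative `∂y/∂xᵢ` of an element of `H¹₀(Ω)`. -/
def H10.deriv {n : ℕ} {Ω : Opens (EuclideanSpace ℝ (Fin n))} (y : H10 Ω) (i : Fin n) : L2 Ω :=
  (y : Jet Ω).snd i

/-- The function `u ∈ L²(Ω)` belongs to `H¹(Ω)`. -/
def MemH1 {n : ℕ} {Ω : Opens (EuclideanSpace ℝ (Fin n))} (u : L2 Ω) : Prop :=
  ∃ w ∈ H1 Ω, w.fst = u

/-- The assumptions on the coefficients of `A y = - ∑ᵢⱼ ∂ⱼ(aᵢⱼ ∂ᵢ y) + c₀ y`. -/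
structure UniformlyElliptic {n : ℕ} (Ω : Opens (EuclideanSpace ℝ (Fin n)))
    (A : EuclideanSpace ℝ (Fin n) → Matrix (Fin n) (Fin n) ℝ)
    (c₀ : EuclideanSpace ℝ (Fin n) → ℝ) : Prop where
  memLp_matrix : ∀ i j, MemLp (fun x => A x i j) ∞ (vol Ω)
  memLp_potential : MemLp c₀ ∞ (vol Ω)
  potential_nonneg : ∀ᵐ x ∂(vol Ω), 0 ≤ c₀ x
  symmetric : ∀ᵐ x ∂(vol Ω), ∀ i j, A x i j = A x j i
  coercive : ∃ θ : ℝ, 0 < θ ∧ ∀ᵐ x ∂(vol Ω), ∀ ξ : EuclideanSpace ℝ (Fin n),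
    θ * ‖ξ‖ ^ 2 ≤ ∑ i, ∑ j, A x i j * ξ i * ξ j

/-- The bilinear form `a(y,v) = ∫_Ω (∑ᵢⱼ aᵢⱼ ∂ᵢy ∂ⱼv + c₀ y v) dx` on `H¹₀(Ω)`. -/
def bilinForm {n : ℕ} {Ω : Opens (EuclideanSpace ℝ (Fin n))}
    (A : EuclideanSpace ℝ (Fin n) → Matrix (Fin n) (Fin n) ℝ)
    (c₀ : EuclideanSpace ℝ (Fin n) → ℝ) (y v : H10 Ω) : ℝ :=
  ∫ x, ((∑ i, ∑ j, A x i j * H10.deriv y i x * H10.deriv v j x)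
    + c₀ x * H10.val y x * H10.val v x) ∂(vol Ω)

/-- `y = 𝒮 f`: `y ∈ H¹₀(Ω)` is the weak solution of `A y = f` in `Ω`, `y = 0` on `∂Ω`. -/
def IsWeakSolution {n : ℕ} {Ω : Opens (EuclideanSpace ℝ (Fin n))}
    (A : EuclideanSpace ℝ (Fin n) → Matrix (Fin n) (Fin n) ℝ)
    (c₀ : EuclideanSpace ℝ (Fin n) → ℝ) (y : H10 Ω) (f : L2 Ω) : Prop :=
  ∀ v : H10 Ω, bilinForm A c₀ y v = inner ℝ f (H10.val v)

/-- `p = 𝒮* f`: `p ∈ H¹₀(Ω)` is the weak solution of the adjoint equation `A* p = f` in `Ω`,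
`p = 0` on `∂Ω`. -/
def IsAdjointSolution {n : ℕ} {Ω : Opens (EuclideanSpace ℝ (Fin n))}
    (A : EuclideanSpace ℝ (Fin n) → Matrix (Fin n) (Fin n) ℝ)
    (c₀ : EuclideanSpace ℝ (Fin n) → ℝ) (p : H10 Ω) (f : L2 Ω) : Prop :=
  ∀ v : H10 Ω, bilinForm A c₀ v p = inner ℝ f (H10.val v)

/-- The admissible set `U_ad = {v ∈ L²(Ω) : a ≤ v ≤ b a.e. on Ω}`. -/
def Uad {n : ℕ} (Ω : Opens (EuclideanSpace ℝ (Fin n))) (a b : ℝ) : Set (L2 Ω) :=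
  {v | ∀ᵐ x ∂(vol Ω), a ≤ v x ∧ v x ≤ b}

/-- The norm of `L¹(Ω)` on `L²(Ω)` (finite, for `Ω` bounded). -/
def normL1 {n : ℕ} {Ω : Opens (EuclideanSpace ℝ (Fin n))} (v : L2 Ω) : ℝ :=
  ∫ x, |v x| ∂(vol Ω)

/-- The cost functional
`J(y,u,z) = ½‖y - y_d‖² + (α/4)‖u‖² + (α/4)‖z‖² + β‖z‖_{L¹}`. -/
def cost {n : ℕ} {Ω : Opens (EuclideanSpace ℝ (Fin n))} (yd : L2 Ω) (α β : ℝ)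
    (w : H10 Ω × L2 Ω × L2 Ω) : ℝ :=
  1 / 2 * ‖H10.val w.1 - yd‖ ^ 2 + α / 4 * ‖w.2.1‖ ^ 2 + α / 4 * ‖w.2.2‖ ^ 2
    + β * normL1 w.2.2

/-- The feasible triples `(y,u,z) ∈ H¹₀(Ω) × L²(Ω) × L²(Ω)`:
`A y = u + y_c` weakly, `u = z`, `z ∈ U_ad`. -/
def feasible {n : ℕ} {Ω : Opens (EuclideanSpace ℝ (Fin n))}
    (A : EuclideanSpace ℝ (Fin n) → Matrix (Fin n) (Fin n) ℝ)
    (c₀ : EuclideanSpace ℝ (Fin n) → ℝ) (yc : L2 Ω) (a b : ℝ) :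
    Set (H10 Ω × L2 Ω × L2 Ω) :=
  {w | IsWeakSolution A c₀ w.1 (w.2.1 + yc) ∧ w.2.1 = w.2.2 ∧ w.2.2 ∈ Uad Ω a b}

/-- `(y,u,z)` is an optimal solution of the control problem. -/
def IsOptimal {n : ℕ} {Ω : Opens (EuclideanSpace ℝ (Fin n))}
    (A : EuclideanSpace ℝ (Fin n) → Matrix (Fin n) (Fin n) ℝ)
    (c₀ : EuclideanSpace ℝ (Fin n) → ℝ) (yc yd : L2 Ω) (a b α β : ℝ)
    (y : H10 Ω) (u z : L2 Ω) : Prop :=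
  (y, u, z) ∈ feasible A c₀ yc a b ∧
    IsMinOn (cost yd α β) (feasible A c₀ yc a b) (y, u, z)

/-- The KKT system with adjoint state `p` and multiplier `lam`. -/
structure KKT {n : ℕ} {Ω : Opens (EuclideanSpace ℝ (Fin n))}
    (A : EuclideanSpace ℝ (Fin n) → Matrix (Fin n) (Fin n) ℝ)
    (c₀ : EuclideanSpace ℝ (Fin n) → ℝ) (yc yd : L2 Ω) (a b α β : ℝ)
    (y : H10 Ω) (u z : L2 Ω) (p : H10 Ω) (lam : L2 Ω) : Prop where
  state : IsWeakSolution A c₀ y (u + yc)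
  adjoint : IsAdjointSolution A c₀ p (yd - H10.val y)
  stationarity : (α / 2) • u - H10.val p + lam = 0
  control_eq : u = z
  admissible : z ∈ Uad Ω a b
  variational : ∀ zt ∈ Uad Ω a b,
    0 ≤ inner ℝ ((α / 2) • z - lam) (zt - z) + β * (normL1 zt - normL1 z)

/-- Soft thresholding `soft(t,β) = sgn(t) max(|t| - β, 0)`. -/
def soft (t β : ℝ) : ℝ :=
  Real.sign t * max (|t| - β) 0

/-- The pointwise projection onto `[a,b]`. -/
def proj (a b t : ℝ) : ℝ :=
  max a (min t b)

end SparseControl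

end

/-!
The feasible set is convex and the cost is the sum of a smooth quadratic and the convex function
`β ‖·‖_{L¹}`, so optimality amounts to a variational inequality. The state and adjoint equations
turn the derivative of the tracking term into `-⟨p, ũ - u⟩`, which leaves
`⟨α u - p, z̃ - u⟩ + β (‖z̃‖_{L¹} - ‖u‖_{L¹}) ≥ 0` for all `z̃ ∈ U_ad`; this is the KKT system with
`λ = p - (α/2) u`. The function `F ∘ p` with `F t = Π(soft(t, β) / α)` satisfies the same inequality
pointwise, and strong monotonicity forces `u = F ∘ p`. Since `F` is Lipschitz, `u ∈ H¹(Ω)`: for a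
test function `φ`, Rademacher's theorem bounds `∫ F(φ) ∂ᵢψ` by `L ‖∂ᵢφ‖ ‖ψ‖`, the bound passes to
the `H¹`-limit `p`, and the Riesz representation theorem recovers the weak gradient of `F ∘ p`.
-/

noncomputable section

open MeasureTheory TopologicalSpace
open scoped Distributions ENNReal

namespace SparseControl

theorem isCoercive_flip {E : Type*} [NormedAddCommGroup E] [NormedSpace ℝ E]
    {B : E →L[ℝ] E →L[ℝ] ℝ} (hB : IsCoercive B) : IsCoercive B.flip := hB

section Hilbert

variable {V H : Type*} [NormedAddCommGroup H] [InnerProductSpace ℝ H] [CompleteSpace H]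

theorem exists_forall_eq_of_isCoercive {B : H →L[ℝ] H →L[ℝ] ℝ} (hB : IsCoercive B)
    (ℓ : H →L[ℝ] ℝ) : ∃ y, ∀ v, B y v = ℓ v := by
  refine ⟨hB.continuousLinearEquivOfBilin.symm ((InnerProductSpace.toDual ℝ H).symm ℓ),
    fun v => ?_⟩
  rw [← hB.continuousLinearEquivOfBilin_apply, ContinuousLinearEquiv.apply_symm_apply,
    InnerProductSpace.toDual_symm_apply]

theorem exists_inner_eq_of_norm_le [AddCommGroup V] [Module ℝ V] (T : V →ₗ[ℝ] H)
    (ℓ : V →ₗ[ℝ] ℝ) {C : ℝ} (h : ∀ v, |ℓ v| ≤ C * ‖T v‖) :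
    ∃ g : H, ∀ v, ℓ v = inner ℝ g (T v) := by
  obtain ⟨G, hG, -⟩ := _root_.exists_extension_norm_eq (LinearMap.range T) (ℓ.compLeftInverse T)
  refine ⟨(InnerProductSpace.toDual ℝ H).symm G, fun v => ?_⟩
  rw [InnerProductSpace.toDual_symm_apply,
    ← LinearMap.compLeftInverse_apply_of_bdd _ _ ⟨C, h⟩ v _ rfl]
  exact (hG _).symm

end Hilbert

theorem isMinOn_add_iff_of_quadratic {V : Type*} [AddCommGroup V] [Module ℝ V] {K : Set V}
    {f j D Q : V → ℝ} {v : V} (hv : v ∈ K) (hj : ConvexOn ℝ K j) (hQ : ∀ w ∈ K, 0 ≤ Q w)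
    (hf : ∀ w ∈ K, ∀ t : ℝ, f (v + t • (w - v)) = f v + t * D w + t ^ 2 * Q w) :
    IsMinOn (fun w => f w + j w) K v ↔ ∀ w ∈ K, 0 ≤ D w + (j w - j v) := by
  refine ⟨fun h w hw => ?_, fun h w hw => ?_⟩
  · have hbound : ∀ t ∈ Set.Ioc (0 : ℝ) 1, 0 ≤ D w + (j w - j v) + t * Q w := by
      rintro t ⟨ht0, ht1⟩
      have hseg : v + t • (w - v) = (1 - t) • v + t • w := by module
      have hmem : v + t • (w - v) ∈ K := hseg ▸
        hj.1 hv hw (sub_nonneg.2 ht1) ht0.le (sub_add_cancel 1 t)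
      have hconv : j (v + t • (w - v)) ≤ (1 - t) * j v + t * j w := hseg ▸
        hj.2 hv hw (sub_nonneg.2 ht1) ht0.le (sub_add_cancel 1 t)
      have hmin : f v + j v ≤ f (v + t • (w - v)) + j (v + t • (w - v)) := h hmem
      rw [hf w hw] at hmin
      exact nonneg_of_mul_nonneg_right (by linarith : 0 ≤ t * (D w + (j w - j v) + t * Q w)) ht0
    have hlim : Filter.Tendsto (fun t => D w + (j w - j v) + t * Q w) (nhdsWithin 0 (Set.Ioi 0))
        (nhds (D w + (j w - j v) + 0 * Q w)) :=
      (Continuous.tendsto (by fun_prop) 0).mono_left nhdsWithin_le_nhds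
    simpa using ge_of_tendsto hlim
      (Filter.eventually_of_mem (Ioc_mem_nhdsGT one_pos) hbound)
  · have hfw := hf w hw 1
    rw [one_smul, add_sub_cancel] at hfw
    change f v + j v ≤ f w + j w
    linarith [h w hw, hQ w hw]

theorem eq_of_variational {H : Type*} [NormedAddCommGroup H] [InnerProductSpace ℝ H]
    {α c : ℝ} (hα : 0 < α) {p u w : H} (hu : 0 ≤ inner ℝ (α • u - p) (w - u) + c)
    (hw : 0 ≤ inner ℝ (α • w - p) (u - w) - c) : u = w := by
  have hsum : inner ℝ (α • u - p) (w - u) + inner ℝ (α • w - p) (u - w)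
      = -(α * ‖u - w‖ ^ 2) := by
    rw [← neg_sub u w, inner_neg_right, neg_add_eq_sub, ← inner_sub_left, sub_sub_sub_cancel_right,
      ← smul_sub, ← neg_sub u w, smul_neg, inner_neg_left, real_inner_smul_left,
      real_inner_self_eq_norm_sq]
  have hle : α * ‖u - w‖ ^ 2 ≤ 0 := by linarith
  simpa [sub_eq_zero] using nonpos_of_mul_nonpos_right hle hα

section Multiplication

variable {X : Type*} {mX : MeasurableSpace X} {μ : Measure X} {g : X → ℝ}

theorem inner_eq_integral_of_ae_eq {f h : Lp ℝ 2 μ} {f' h' : X → ℝ} (hf : f =ᵐ[μ] f')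
    (hh : h =ᵐ[μ] h') : inner ℝ f h = ∫ x, f' x * h' x ∂μ := by
  rw [L2.inner_def]
  refine integral_congr_ae ?_
  filter_upwards [hf, hh] with x hfx hhx
  rw [Real.inner_apply, hfx, hhx]

/-- Multiplication by a function `g ∈ L^∞`, as a bounded operator on `L²`. -/
def mulCLM (hg : MemLp g ∞ μ) : Lp ℝ 2 μ →L[ℝ] Lp ℝ 2 μ :=
  (ContinuousLinearMap.lsmul ℝ ℝ).holderL μ ∞ 2 2 (hg.toLp g)

theorem coeFn_mulCLM (hg : MemLp g ∞ μ) (f : Lp ℝ 2 μ) : mulCLM hg f =ᵐ[μ] fun x => g x * f x := by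
  filter_upwards [(ContinuousLinearMap.lsmul ℝ ℝ).coeFn_holder (r := 2) (hg.toLp g) f,
    hg.coeFn_toLp] with x hx hgx
  rw [← hgx]
  exact hx

theorem integrable_weighted (hg : MemLp g ∞ μ) (f h : Lp ℝ 2 μ) :
    Integrable (fun x => g x * f x * h x) μ :=
  (L2.integrable_inner (𝕜 := ℝ) h (mulCLM hg f)).congr <| by
    filter_upwards [coeFn_mulCLM hg f] with x hx
    rw [Real.inner_apply, hx, mul_comm]

/-- The bounded bilinear form `(f, h) ↦ ∫ g f h` on `L²` with weight `g ∈ L^∞`. -/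
def weightedForm (hg : MemLp g ∞ μ) : Lp ℝ 2 μ →L[ℝ] Lp ℝ 2 μ →L[ℝ] ℝ :=
  innerSL ℝ ∘L mulCLM hg

theorem weightedForm_apply (hg : MemLp g ∞ μ) (f h : Lp ℝ 2 μ) :
    weightedForm hg f h = ∫ x, g x * f x * h x ∂μ :=
  inner_eq_integral_of_ae_eq (coeFn_mulCLM hg f) .rfl

end Multiplication

section Composition

variable {X : Type*} {mX : MeasurableSpace X} {μ : Measure X} [IsFiniteMeasure μ]
  {F : ℝ → ℝ} {L : NNReal}

/-- The composition `F ∘ f` of a Lipschitz function with `f ∈ L²(μ)`, for finite `μ`. The constant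
`F 0` is split off because `LipschitzWith.compLp` is available only for functions vanishing at
`0`. -/
def lipschitzComp (hF : LipschitzWith L F) (f : Lp ℝ 2 μ) : Lp ℝ 2 μ :=
  LipschitzWith.compLp (g := fun t => F t - F 0) (c := L)
    (fun s t => by simpa only [edist_sub_right] using hF s t) (sub_self (F 0)) f
    + Lp.const 2 μ (F 0)

theorem coeFn_lipschitzComp (hF : LipschitzWith L F) (f : Lp ℝ 2 μ) :
    ∀ᵐ x ∂μ, lipschitzComp hF f x = F (f x) := by
  filter_upwards [Lp.coeFn_add _ (Lp.const 2 μ (F 0)),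
    LipschitzWith.coeFn_compLp (g := fun t => F t - F 0) (c := L)
      (fun s t => by simpa only [edist_sub_right] using hF s t) (sub_self (F 0)) f,
    Lp.coeFn_const 2 μ (F 0)] with x hadd hcomp hconst
  rw [lipschitzComp, hadd, Pi.add_apply, hcomp, hconst, Function.comp_apply, Function.const_apply,
    sub_add_cancel]

end Composition

section TestFunctions

variable {n : ℕ} {Ω : Opens (EuclideanSpace ℝ (Fin n))}

/-- The inclusion of `C_c^∞(Ω)` into `L²(Ω)`. -/
def testToL2 : 𝓓(Ω, ℝ) →ₗ[ℝ] L2 Ω where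
  toFun φ := (memLp_testFunction φ).toLp φ
  map_add' φ ψ := MemLp.toLp_add (memLp_testFunction φ) (memLp_testFunction ψ)
  map_smul' c φ := MemLp.toLp_const_smul c (memLp_testFunction φ)

theorem coeFn_testToL2 (φ : 𝓓(Ω, ℝ)) : testToL2 φ =ᵐ[vol Ω] φ :=
  (memLp_testFunction φ).coeFn_toLp

theorem inner_testToL2 (f : L2 Ω) (φ : 𝓓(Ω, ℝ)) :
    inner ℝ f (testToL2 φ) = ∫ x, f x * φ x ∂(vol Ω) :=
  inner_eq_integral_of_ae_eq .rfl (coeFn_testToL2 φ)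

/-- The partial derivative `∂/∂xᵢ` as an operator on `C_c^∞(Ω)`. -/
def testPartial (i : Fin n) : 𝓓(Ω, ℝ) →ₗ[ℝ] 𝓓(Ω, ℝ) :=
  (TestFunction.lineDerivCLM ℝ (EuclideanSpace.single i 1)).toLinearMap

theorem lineDeriv_testFunction (φ : 𝓓(Ω, ℝ)) (i : Fin n) (x : EuclideanSpace ℝ (Fin n)) :
    lineDeriv ℝ φ x (EuclideanSpace.single i 1) = partialDeriv φ i x :=
  (φ.contDiff.differentiable (by simp) x).lineDeriv_eq_fderiv

theorem coe_testPartial (i : Fin n) (φ : 𝓓(Ω, ℝ)) : ⇑(testPartial i φ) = partialDeriv φ i :=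
  funext fun x => (TestFunction.lineDerivCLM_apply_of_le le_top).trans
    (lineDeriv_testFunction φ i x)

theorem testJet_eq (φ : 𝓓(Ω, ℝ)) :
    testJet φ = WithLp.toLp 2 (testToL2 φ, WithLp.toLp 2 fun i => testToL2 (testPartial i φ)) := by
  simp only [testJet, testToL2, LinearMap.coe_mk, AddHom.coe_mk, coe_testPartial]

/-- `testJet` as a linear map. -/
def testJetₗ : 𝓓(Ω, ℝ) →ₗ[ℝ] Jet Ω where
  toFun := testJet
  map_add' φ ψ := by
    simp only [testJet_eq, map_add]
    rfl
  map_smul' c φ := by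
    simp only [testJet_eq, map_smul]
    rfl

theorem testFunction_eq_zero (φ : 𝓓(Ω, ℝ)) {x : EuclideanSpace ℝ (Fin n)} (hx : x ∉ Ω) :
    φ x = 0 :=
  image_eq_zero_of_notMem_tsupport fun h => hx (φ.tsupport_subset h)

theorem exists_lipschitzWith_testFunction (φ : 𝓓(Ω, ℝ)) : ∃ C, LipschitzWith C φ :=
  φ.contDiff.lipschitzWith_of_hasCompactSupport φ.hasCompactSupport (by simp)

theorem integral_mul_partialDeriv {f : EuclideanSpace ℝ (Fin n) → ℝ} {C : NNReal}
    (hf : LipschitzWith C f) (ψ : 𝓓(Ω, ℝ)) (i : Fin n) :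
    ∫ x, f x * partialDeriv ψ i x ∂(vol Ω)
      = - ∫ x, lineDeriv ℝ f x (EuclideanSpace.single i 1) * ψ x ∂(vol Ω) := by
  obtain ⟨D, hD⟩ := exists_lipschitzWith_testFunction ψ
  have hparts := hf.integral_lineDeriv_mul_eq (μ := volume) hD ψ.hasCompactSupport
    (EuclideanSpace.single i 1)
  simp only [lineDeriv_neg, lineDeriv_testFunction, neg_mul, integral_neg] at hparts
  rw [setIntegral_eq_integral_of_forall_compl_eq_zero fun x hx => by
      rw [← coe_testPartial, testFunction_eq_zero _ hx, mul_zero],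
    setIntegral_eq_integral_of_forall_compl_eq_zero fun x hx => by
      rw [testFunction_eq_zero ψ hx, mul_zero], hparts, neg_neg]
  simp only [mul_comm]

theorem inner_testToL2_testPartial (φ ψ : 𝓓(Ω, ℝ)) (i : Fin n) :
    inner ℝ (testToL2 φ) (testToL2 (testPartial i ψ))
      = - inner ℝ (testToL2 (testPartial i φ)) (testToL2 ψ) := by
  obtain ⟨C, hC⟩ := exists_lipschitzWith_testFunction φ
  have hparts := integral_mul_partialDeriv hC ψ i
  simp only [lineDeriv_testFunction, ← coe_testPartial] at hparts
  rw [inner_eq_integral_of_ae_eq (coeFn_testToL2 φ) (coeFn_testToL2 _), hparts,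
    inner_eq_integral_of_ae_eq (coeFn_testToL2 _) (coeFn_testToL2 ψ)]

end TestFunctions

section Sobolev

variable {n : ℕ} {Ω : Opens (EuclideanSpace ℝ (Fin n))}

theorem isWeakGradient_iff {y : L2 Ω} {g : Fin n → L2 Ω} :
    IsWeakGradient y g ↔ ∀ (φ : 𝓓(Ω, ℝ)) (i : Fin n),
      inner ℝ y (testToL2 (testPartial i φ)) = - inner ℝ (g i) (testToL2 φ) := by
  simp only [inner_testToL2, coe_testPartial, IsWeakGradient]

theorem isClosed_H1 : IsClosed (H1 Ω : Set (Jet Ω)) := by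
  have hH1 : (H1 Ω : Set (Jet Ω)) = {w | IsWeakGradient w.fst w.snd} := rfl
  simp only [hH1, isWeakGradient_iff, Set.ofPred_forall]
  refine isClosed_iInter fun φ => isClosed_iInter fun i => isClosed_eq ?_ ?_ <;> fun_prop

instance : CompleteSpace (H10 Ω) :=
  (isClosed_H1.inter (Submodule.isClosed_topologicalClosure _)).completeSpace_coe

theorem H10.mem_of_isClosed (y : H10 Ω) {s : Set (Jet Ω)} (hs : IsClosed s)
    (h : ∀ φ : 𝓓(Ω, ℝ), testJet φ ∈ s) : (y : Jet Ω) ∈ s := by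
  have hspan : (Submodule.span ℝ (Set.range (testJet (Ω := Ω))) : Set (Jet Ω))
      = Set.range (testJet (Ω := Ω)) :=
    congrArg _ (Submodule.span_eq (LinearMap.range (testJetₗ (Ω := Ω))))
  exact hs.closure_subset_iff.2 (hspan.trans_subset (Set.range_subset_iff.2 h)) y.2.2

theorem MemH1.add {u v : L2 Ω} (hu : MemH1 u) (hv : MemH1 v) : MemH1 (u + v) := by
  obtain ⟨w, hw, rfl⟩ := hu
  obtain ⟨w', hw', rfl⟩ := hv
  exact ⟨w + w', add_mem hw hw', rfl⟩

theorem memH1_of_abs_inner_le (u : L2 Ω) (C : Fin n → ℝ)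
    (h : ∀ (φ : 𝓓(Ω, ℝ)) (i : Fin n),
      |inner ℝ u (testToL2 (testPartial i φ))| ≤ C i * ‖testToL2 φ‖) : MemH1 u := by
  choose g hg using fun i => exists_inner_eq_of_norm_le testToL2
    ((innerSL ℝ u).toLinearMap ∘ₗ testToL2 ∘ₗ testPartial i) (fun φ => h φ i)
  refine ⟨WithLp.toLp 2 (u, WithLp.toLp 2 fun i => - g i), isWeakGradient_iff.2 fun φ i => ?_, rfl⟩
  exact (hg i φ).trans (neg_eq_iff_eq_neg.1 (inner_neg_left _ _).symm)

theorem memH1_const [IsFiniteMeasure (vol Ω)] (c : ℝ) : MemH1 (Lp.const 2 (vol Ω) c) := by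
  refine memH1_of_abs_inner_le _ 0 fun φ i => ?_
  have hparts := integral_mul_partialDeriv (LipschitzWith.const c) φ i
  simp only [lineDeriv, deriv_const, zero_mul, integral_zero, neg_zero] at hparts
  rw [inner_eq_integral_of_ae_eq (Lp.coeFn_const 2 (vol Ω) c) (coeFn_testToL2 _), coe_testPartial,
    Pi.zero_apply, zero_mul, abs_nonpos_iff]
  exact hparts

theorem abs_lineDeriv_comp_le {E : Type*} [AddCommGroup E] [Module ℝ E]
    {F : ℝ → ℝ} {L : NNReal} (hF : LipschitzWith L F) {f : E → ℝ} {x v : E}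
    (hf : LineDifferentiableAt ℝ f x v) :
    |lineDeriv ℝ (F ∘ f) x v| ≤ L * |lineDeriv ℝ f x v| := by
  by_cases h : LineDifferentiableAt ℝ (F ∘ f) x v
  · have hlim := h.hasLineDerivAt.tendsto_slope_zero_right.abs
    have hlim' := (hf.hasLineDerivAt.tendsto_slope_zero_right.abs).const_mul (L : ℝ)
    refine le_of_tendsto_of_tendsto' hlim hlim' fun t => ?_
    rw [smul_eq_mul, smul_eq_mul, abs_mul, abs_mul, mul_left_comm]
    gcongr
    exact hF.dist_le_mul _ _
  · rw [lineDeriv_zero_of_not_lineDifferentiableAt h, abs_zero]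
    positivity

theorem abs_integral_comp_mul_partialDeriv_le {F : ℝ → ℝ} {L : NNReal} (hF : LipschitzWith L F)
    (φ ψ : 𝓓(Ω, ℝ)) (i : Fin n) :
    |∫ x, F (φ x) * partialDeriv ψ i x ∂(vol Ω)|
      ≤ L * ‖testToL2 (testPartial i φ)‖ * ‖testToL2 ψ‖ := by
  obtain ⟨C, hC⟩ := exists_lipschitzWith_testFunction φ
  let d : EuclideanSpace ℝ (Fin n) → ℝ :=
    fun x => lineDeriv ℝ (F ∘ φ) x (EuclideanSpace.single i 1)
  have hd_le : ∀ x, ‖d x‖ ≤ L * ‖testPartial i φ x‖ := fun x => by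
    rw [coe_testPartial, ← lineDeriv_testFunction]
    exact abs_lineDeriv_comp_le hF
      (φ.contDiff.differentiable (by simp) x).lineDifferentiableAt
  have hd : MemLp d 2 (vol Ω) := (memLp_testFunction (testPartial i φ)).of_le_mul
    (measurable_lineDeriv (hF.continuous.comp φ.continuous)).aestronglyMeasurable
    (.of_forall hd_le)
  have hd_norm : ‖hd.toLp d‖ ≤ L * ‖testToL2 (testPartial i φ)‖ := by
    refine Lp.norm_le_mul_norm_of_ae_le_mul ?_
    filter_upwards [hd.coeFn_toLp, coeFn_testToL2 (testPartial i φ)] with x hx hφx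
    rw [hx, hφx]
    exact hd_le x
  have hparts : ∫ x, F (φ x) * partialDeriv ψ i x ∂(vol Ω)
      = - inner ℝ (hd.toLp d) (testToL2 ψ) := by
    rw [inner_eq_integral_of_ae_eq hd.coeFn_toLp (coeFn_testToL2 ψ)]
    exact integral_mul_partialDeriv (hF.comp hC) ψ i
  rw [hparts, abs_neg]
  exact (abs_real_inner_le_norm _ _).trans (by gcongr)

theorem memH1_compLp {F : ℝ → ℝ} {L : NNReal} (hF : LipschitzWith L F) (hF0 : F 0 = 0)
    (y : H10 Ω) : MemH1 (hF.compLp hF0 (H10.val y)) := by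
  refine memH1_of_abs_inner_le _ (fun i => L * ‖H10.deriv y i‖) fun ψ i => ?_
  have hc := hF.continuous_compLp (p := 2) (μ := vol Ω) hF0
  refine H10.mem_of_isClosed y (s := {w : Jet Ω |
    |inner ℝ (hF.compLp hF0 w.fst) (testToL2 (testPartial i ψ))|
      ≤ L * ‖w.snd i‖ * ‖testToL2 ψ‖})
    (isClosed_le (by fun_prop) (by fun_prop)) fun φ => ?_
  rw [testJet_eq]
  refine le_of_eq_of_le (congrArg _ ?_) (abs_integral_comp_mul_partialDeriv_le hF φ ψ i)
  have hcomp : hF.compLp hF0 (testToL2 φ) =ᵐ[vol Ω] fun x => F (φ x) := by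
    filter_upwards [hF.coeFn_compLp hF0 (testToL2 φ), coeFn_testToL2 φ] with x hx hφx
    rw [hx, Function.comp_apply, hφx]
  rw [← coe_testPartial]
  exact inner_eq_integral_of_ae_eq hcomp (coeFn_testToL2 _)

theorem memH1_lipschitzComp [IsFiniteMeasure (vol Ω)] {F : ℝ → ℝ} {L : NNReal}
    (hF : LipschitzWith L F) (y : H10 Ω) : MemH1 (lipschitzComp hF (H10.val y)) :=
  (memH1_compLp _ _ y).add (memH1_const (F 0))

end Sobolev

section Poincare

variable {n : ℕ} {Ω : Opens (EuclideanSpace ℝ (Fin n))}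

/-- The product `xᵢ φ` of a test function with a coordinate. -/
def coordMul (i : Fin n) (φ : 𝓓(Ω, ℝ)) : 𝓓(Ω, ℝ) where
  toFun x := x i * φ x
  contDiff' := (contDiff_euclidean.1 contDiff_id i).mul φ.contDiff
  hasCompactSupport' := φ.hasCompactSupport.mul_left
  tsupport_subset' := tsupport_mul_subset_right.trans φ.tsupport_subset

theorem testPartial_coordMul (i : Fin n) (φ : 𝓓(Ω, ℝ)) :
    testPartial i (coordMul i φ) = φ + coordMul i (testPartial i φ) := by
  ext x
  have hcoord : HasFDerivAt (fun x : EuclideanSpace ℝ (Fin n) => x i)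
      (EuclideanSpace.proj i : EuclideanSpace ℝ (Fin n) →L[ℝ] ℝ) x :=
    (EuclideanSpace.proj i : EuclideanSpace ℝ (Fin n) →L[ℝ] ℝ).hasFDerivAt
  have hmul : fderiv ℝ (coordMul i φ) x = _ :=
    (hcoord.mul (φ.contDiff.differentiable (by simp) x).hasFDerivAt).fderiv
  change testPartial i (coordMul i φ) x = φ x + x i * testPartial i φ x
  simp [coe_testPartial, partialDeriv, hmul, add_comm]

theorem inner_testToL2_coordMul (i : Fin n) (φ ψ : 𝓓(Ω, ℝ)) :
    inner ℝ (testToL2 φ) (testToL2 (coordMul i ψ))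
      = inner ℝ (testToL2 ψ) (testToL2 (coordMul i φ)) := by
  rw [inner_eq_integral_of_ae_eq (coeFn_testToL2 φ) (coeFn_testToL2 _),
    inner_eq_integral_of_ae_eq (coeFn_testToL2 ψ) (coeFn_testToL2 _)]
  refine integral_congr_ae (.of_forall fun x => ?_)
  change φ x * (x i * ψ x) = ψ x * (x i * φ x)
  ring

theorem norm_testToL2_sq (i : Fin n) (φ : 𝓓(Ω, ℝ)) :
    ‖testToL2 φ‖ ^ 2 = -(2 * inner ℝ (testToL2 (testPartial i φ)) (testToL2 (coordMul i φ))) := by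
  have hparts := inner_testToL2_testPartial φ (coordMul i φ) i
  rw [testPartial_coordMul, map_add, inner_add_right, real_inner_self_eq_norm_sq,
    inner_testToL2_coordMul] at hparts
  linarith

theorem norm_testToL2_le {R : ℝ} {i : Fin n} (hR : 0 ≤ R) (hΩ : ∀ x ∈ Ω, |x i| ≤ R)
    (φ : 𝓓(Ω, ℝ)) : ‖testToL2 φ‖ ≤ 2 * R * ‖testToL2 (testPartial i φ)‖ := by
  have hcoord : ‖testToL2 (coordMul i φ)‖ ≤ R * ‖testToL2 φ‖ := by
    refine Lp.norm_le_mul_norm_of_ae_le_mul ?_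
    filter_upwards [coeFn_testToL2 φ, coeFn_testToL2 (coordMul i φ),
      ae_restrict_mem Ω.isOpen.measurableSet] with x hφ hcφ hx
    rw [hφ, hcφ]
    exact (norm_mul_le _ _).trans (mul_le_mul_of_nonneg_right (hΩ x hx) (norm_nonneg _))
  have hsq : ‖testToL2 φ‖ * ‖testToL2 φ‖
      ≤ 2 * R * ‖testToL2 (testPartial i φ)‖ * ‖testToL2 φ‖ := calc
    _ = 2 * -inner ℝ (testToL2 (testPartial i φ)) (testToL2 (coordMul i φ)) := by
      rw [← sq, norm_testToL2_sq i]
      ring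
    _ ≤ 2 * (‖testToL2 (testPartial i φ)‖ * ‖testToL2 (coordMul i φ)‖) := by
      gcongr
      exact (neg_le_abs _).trans (abs_real_inner_le_norm _ _)
    _ ≤ 2 * (‖testToL2 (testPartial i φ)‖ * (R * ‖testToL2 φ‖)) := by gcongr
    _ = _ := by ring
  rcases (norm_nonneg (testToL2 φ)).eq_or_lt with hzero | hpos
  · rw [← hzero]
    positivity
  · exact le_of_mul_le_mul_right hsq hpos

theorem H10.norm_val_le {R : ℝ} {i : Fin n} (hR : 0 ≤ R) (hΩ : ∀ x ∈ Ω, |x i| ≤ R) (y : H10 Ω) :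
    ‖H10.val y‖ ≤ 2 * R * ‖H10.deriv y i‖ :=
  H10.mem_of_isClosed y (s := {w : Jet Ω | ‖w.fst‖ ≤ 2 * R * ‖w.snd i‖})
    (isClosed_le (by fun_prop) (by fun_prop)) fun φ => by
      rw [testJet_eq]
      exact norm_testToL2_le hR hΩ φ

end Poincare

section EllipticForm

variable {n : ℕ} {Ω : Opens (EuclideanSpace ℝ (Fin n))}

/-- The inclusion of `H¹₀(Ω)` into `L²(Ω)` as a bounded operator. -/
def H10.valCLM : H10 Ω →L[ℝ] L2 Ω :=
  WithLp.fstL 2 ℝ (L2 Ω) (PiLp 2 fun _ : Fin n => L2 Ω) ∘L (H10 Ω).subtypeL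

/-- The weak partial derivative `∂/∂xᵢ` as a bounded operator from `H¹₀(Ω)` to `L²(Ω)`. -/
def H10.derivCLM (i : Fin n) : H10 Ω →L[ℝ] L2 Ω :=
  PiLp.proj 2 (fun _ : Fin n => L2 Ω) i ∘L
    WithLp.sndL 2 ℝ (L2 Ω) (PiLp 2 fun _ : Fin n => L2 Ω) ∘L (H10 Ω).subtypeL

theorem H10.norm_sq (y : H10 Ω) :
    ‖y‖ ^ 2 = ‖H10.val y‖ ^ 2 + ∑ i, ‖H10.deriv y i‖ ^ 2 := by
  change ‖(y : Jet Ω)‖ ^ 2 = _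
  rw [WithLp.prod_norm_sq_eq_of_L2, PiLp.norm_sq_eq_of_L2]
  rfl

variable {A : EuclideanSpace ℝ (Fin n) → Matrix (Fin n) (Fin n) ℝ}
  {c₀ : EuclideanSpace ℝ (Fin n) → ℝ}

/-- The form `bilinForm A c₀` with essentially bounded coefficients, as a bounded bilinear form
on `H¹₀(Ω)`. -/
def bilinFormCLM (hA : ∀ i j, MemLp (fun x => A x i j) ∞ (vol Ω)) (hc₀ : MemLp c₀ ∞ (vol Ω)) :
    H10 Ω →L[ℝ] H10 Ω →L[ℝ] ℝ :=
  (∑ i, ∑ j, (weightedForm (hA i j)).bilinearComp (H10.derivCLM i) (H10.derivCLM j))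
    + (weightedForm hc₀).bilinearComp H10.valCLM H10.valCLM

theorem integrable_bilinForm (hA : ∀ i j, MemLp (fun x => A x i j) ∞ (vol Ω)) (y v : H10 Ω) :
    Integrable (fun x => ∑ i, ∑ j, A x i j * H10.deriv y i x * H10.deriv v j x) (vol Ω) :=
  integrable_finsetSum _ fun i _ => integrable_finsetSum _ fun j _ =>
    integrable_weighted (hA i j) _ _

theorem bilinFormCLM_apply (hA : ∀ i j, MemLp (fun x => A x i j) ∞ (vol Ω))
    (hc₀ : MemLp c₀ ∞ (vol Ω)) (y v : H10 Ω) :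
    bilinFormCLM hA hc₀ y v = bilinForm A c₀ y v := by
  have hint : ∀ i j, Integrable (fun x => A x i j * H10.deriv y i x * H10.deriv v j x) (vol Ω) :=
    fun i j => integrable_weighted (hA i j) _ _
  rw [bilinForm, integral_add (integrable_bilinForm hA y v) (integrable_weighted hc₀ _ _),
    integral_finsetSum _ fun i _ => integrable_finsetSum _ fun j _ => hint i j]
  simp_rw [integral_finsetSum _ fun j _ => hint _ j]
  simp only [bilinFormCLM, add_apply, sum_apply,
    ContinuousLinearMap.bilinearComp_apply, weightedForm_apply]
  rfl

theorem UniformlyElliptic.exists_le_bilinForm_self (h : UniformlyElliptic Ω A c₀) :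
    ∃ θ : ℝ, 0 < θ ∧ ∀ y : H10 Ω, θ * ∑ i, ‖H10.deriv y i‖ ^ 2 ≤ bilinForm A c₀ y y := by
  obtain ⟨θ, hθ, hell⟩ := h.coercive
  refine ⟨θ, hθ, fun y => ?_⟩
  have hsq : ∀ i, Integrable (fun x => H10.deriv y i x * H10.deriv y i x) (vol Ω) := fun i =>
    (Lp.memLp _).integrable_mul (Lp.memLp _)
  have hnorm : ∑ i, ‖H10.deriv y i‖ ^ 2
      = ∫ x, ∑ i, H10.deriv y i x * H10.deriv y i x ∂(vol Ω) := by
    simp_rw [integral_finsetSum _ fun i _ => hsq i, ← real_inner_self_eq_norm_sq,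
      inner_eq_integral_of_ae_eq .rfl .rfl]
  rw [hnorm, ← integral_const_mul]
  refine integral_mono_ae ((integrable_finsetSum _ fun i _ => hsq i).const_mul θ)
    ((integrable_bilinForm h.memLp_matrix y y).add
      (integrable_weighted h.memLp_potential _ _)) ?_
  filter_upwards [hell, h.potential_nonneg] with x hx hcx
  have hxy := hx (WithLp.toLp 2 fun i => H10.deriv y i x)
  rw [EuclideanSpace.real_norm_sq_eq] at hxy
  simp only [sq] at hxy
  refine hxy.trans (le_add_of_nonneg_right ?_)
  rw [mul_assoc]
  exact mul_nonneg hcx (mul_self_nonneg _)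

theorem UniformlyElliptic.isCoercive (h : UniformlyElliptic Ω A c₀) (hn : 0 < n)
    (hΩ : Bornology.IsBounded (Ω : Set (EuclideanSpace ℝ (Fin n)))) :
    IsCoercive (bilinFormCLM h.memLp_matrix h.memLp_potential) := by
  obtain ⟨θ, hθ, hle⟩ := h.exists_le_bilinForm_self
  obtain ⟨R, hR, hΩR⟩ := hΩ.exists_pos_norm_le
  let i : Fin n := ⟨0, hn⟩
  refine ⟨θ / ((2 * R) ^ 2 + 1), by positivity, fun y => ?_⟩
  have hpoincare : ‖H10.val y‖ ^ 2 ≤ (2 * R) ^ 2 * ∑ j, ‖H10.deriv y j‖ ^ 2 := calc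
    ‖H10.val y‖ ^ 2 ≤ (2 * R * ‖H10.deriv y i‖) ^ 2 := by
      gcongr
      exact H10.norm_val_le hR.le (fun x hx => (PiLp.norm_apply_le x i).trans (hΩR x hx)) y
    _ = (2 * R) ^ 2 * ‖H10.deriv y i‖ ^ 2 := mul_pow _ _ _
    _ ≤ (2 * R) ^ 2 * ∑ j, ‖H10.deriv y j‖ ^ 2 := by
      gcongr
      exact Finset.single_le_sum (f := fun j => ‖H10.deriv y j‖ ^ 2) (fun j _ => sq_nonneg _)
        (Finset.mem_univ i)
  rw [bilinFormCLM_apply, mul_assoc, ← sq, div_mul_eq_mul_div, div_le_iff₀ (by positivity),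
    H10.norm_sq]
  calc θ * (‖H10.val y‖ ^ 2 + ∑ j, ‖H10.deriv y j‖ ^ 2)
      ≤ θ * ((2 * R) ^ 2 * ∑ j, ‖H10.deriv y j‖ ^ 2 + ∑ j, ‖H10.deriv y j‖ ^ 2) := by gcongr
    _ = θ * ∑ j, ‖H10.deriv y j‖ ^ 2 * ((2 * R) ^ 2 + 1) := by rw [← Finset.sum_mul]; ring
    _ ≤ bilinForm A c₀ y y * ((2 * R) ^ 2 + 1) := by
      rw [← Finset.sum_mul, ← mul_assoc]
      gcongr
      exact hle y

end EllipticForm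

section WeakSolutions

variable {n : ℕ} {Ω : Opens (EuclideanSpace ℝ (Fin n))}
  {A : EuclideanSpace ℝ (Fin n) → Matrix (Fin n) (Fin n) ℝ} {c₀ : EuclideanSpace ℝ (Fin n) → ℝ}
  {hA : ∀ i j, MemLp (fun x => A x i j) ∞ (vol Ω)} {hc₀ : MemLp c₀ ∞ (vol Ω)}

theorem H10.exists_forall_eq_inner {B : H10 Ω →L[ℝ] H10 Ω →L[ℝ] ℝ} (hB : IsCoercive B)
    (f : L2 Ω) : ∃ y : H10 Ω, ∀ v, B y v = inner ℝ f (H10.val v) :=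
  exists_forall_eq_of_isCoercive (H := H10 Ω) hB ((innerSL ℝ f).comp H10.valCLM)

theorem exists_isWeakSolution (hB : IsCoercive (bilinFormCLM hA hc₀)) (f : L2 Ω) :
    ∃ y : H10 Ω, IsWeakSolution A c₀ y f := by
  obtain ⟨y, hy⟩ := H10.exists_forall_eq_inner hB f
  exact ⟨y, fun v => (bilinFormCLM_apply hA hc₀ y v).symm.trans (hy v)⟩

theorem exists_isAdjointSolution (hB : IsCoercive (bilinFormCLM hA hc₀)) (f : L2 Ω) :
    ∃ p : H10 Ω, IsAdjointSolution A c₀ p f := by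
  obtain ⟨p, hp⟩ := H10.exists_forall_eq_inner (isCoercive_flip hB) f
  exact ⟨p, fun v => (bilinFormCLM_apply hA hc₀ v p).symm.trans (hp v)⟩

end WeakSolutions

section SoftThresholding

variable {a b α β : ℝ}

theorem soft_eq (hβ : 0 ≤ β) (p : ℝ) : soft p β = max (p - β) 0 + min (p + β) 0 := by
  rw [soft]
  rcases lt_trichotomy p 0 with hp | rfl | hp
  · rw [Real.sign_of_neg hp, abs_of_neg hp, max_eq_right (by linarith : p - β ≤ 0), zero_add,
      neg_one_mul, ← min_neg_neg, neg_sub, sub_neg_eq_add, neg_zero, add_comm]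
  · simp [hβ]
  · rw [Real.sign_of_pos hp, abs_of_pos hp, min_eq_right (by linarith : 0 ≤ p + β), one_mul,
      add_zero]

theorem exists_lipschitzWith_proj_soft (a b α : ℝ) (hβ : 0 ≤ β) :
    ∃ L, LipschitzWith L fun t => proj a b (1 / α * soft t β) := by
  have hsub : LipschitzWith (1 + 0) fun t : ℝ => t - β := LipschitzWith.id.sub (.const β)
  have hadd : LipschitzWith (1 + 0) fun t : ℝ => t + β := LipschitzWith.id.add (.const β)
  have hsoft : LipschitzWith (1 + 0 + (1 + 0)) fun t => soft t β := by
    simpa only [← soft_eq hβ] using (hsub.max_const 0).add (hadd.min_const 0)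
  exact ⟨_, (((lipschitzWith_smul (1 / α)).comp hsoft).min_const b).const_max a⟩

theorem abs_sub_soft_le (hβ : 0 ≤ β) (p : ℝ) : |p - soft p β| ≤ β := by
  rw [soft_eq hβ, abs_le]
  constructor <;> grind

theorem sub_soft_mul_soft (hβ : 0 ≤ β) (p : ℝ) : (p - soft p β) * soft p β = β * |soft p β| := by
  rw [soft_eq hβ]
  rcases lt_or_ge β p with hp | hp
  · rw [max_eq_left (by linarith), min_eq_right (by linarith), add_zero, sub_sub_cancel,
      abs_of_nonneg (by linarith)]
  rcases lt_or_ge p (-β) with hp' | hp'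
  · rw [max_eq_right (by linarith), min_eq_left (by linarith), zero_add, sub_add_cancel_left,
      abs_of_nonpos (by linarith), neg_mul_comm]
  · rw [max_eq_right (by linarith), min_eq_right (by linarith)]
    simp

theorem soft_variational (hα : 0 < α) (hβ : 0 ≤ β) (p t : ℝ) :
    0 ≤ (α * (1 / α * soft p β) - p) * (t - 1 / α * soft p β)
      + (β * |t| - β * |1 / α * soft p β|) := by
  have hbound : (p - soft p β) * t ≤ β * |t| :=
    (le_abs_self _).trans ((abs_mul _ _).trans_le (by gcongr; exact abs_sub_soft_le hβ p))
  have heq : (p - soft p β) * (1 / α * soft p β) = β * |1 / α * soft p β| := by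
    rw [mul_left_comm, sub_soft_mul_soft hβ, abs_mul, abs_of_pos (one_div_pos.2 hα), mul_left_comm]
  rw [← mul_assoc, mul_one_div_cancel hα.ne', one_mul]
  linarith

theorem proj_mem_Icc (hab : a ≤ b) (t : ℝ) : proj a b t ∈ Set.Icc a b :=
  ⟨le_max_left _ _, max_le hab (min_le_right _ _)⟩

theorem proj_mem_segment {t : ℝ} (ht : t ∈ Set.Icc a b) (m : ℝ) :
    proj a b m ∈ segment ℝ m t := by
  rw [segment_eq_uIcc, Set.mem_uIcc, proj]
  grind

-- Along the segment from `m` to `t`, which contains `proj a b m`, convexity scales the inequality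
-- at `m` by a factor in `[0, 1]`.
theorem proj_variational {φ : ℝ → ℝ} (hφ : ConvexOn ℝ Set.univ φ) {p m : ℝ} (hα : 0 ≤ α)
    (h : ∀ t, 0 ≤ (α * m - p) * (t - m) + (φ t - φ m)) {t : ℝ} (ht : t ∈ Set.Icc a b) :
    0 ≤ (α * proj a b m - p) * (t - proj a b m) + (φ t - φ (proj a b m)) := by
  obtain ⟨r, s, hr, hs, hrs, hw⟩ := proj_mem_segment ht m
  have hconv := hφ.2 (Set.mem_univ m) (Set.mem_univ t) hr hs hrs
  rw [hw] at hconv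
  simp only [smul_eq_mul] at hconv hw
  obtain rfl : s = 1 - r := by linarith
  have hscaled := mul_nonneg hr (h t)
  have hquad : 0 ≤ α * ((1 - r) * r * (t - m) ^ 2) := by positivity
  rw [← hw] at hconv ⊢
  linarith

theorem proj_soft_variational (hα : 0 < α) (hβ : 0 ≤ β) (p : ℝ) {t : ℝ} (ht : t ∈ Set.Icc a b) :
    0 ≤ (α * proj a b (1 / α * soft p β) - p) * (t - proj a b (1 / α * soft p β))
      + (β * |t| - β * |proj a b (1 / α * soft p β)|) :=
  proj_variational ((convexOn_univ_norm (E := ℝ)).smul hβ) hα.le (soft_variational hα hβ p) ht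

end SoftThresholding

section ReducedCost

variable {n : ℕ} {Ω : Opens (EuclideanSpace ℝ (Fin n))} {yd : L2 Ω} {a b α β : ℝ}

theorem coeFn_smul_add_smul (r s : ℝ) (f g : L2 Ω) :
    ⇑(r • f + s • g) =ᵐ[vol Ω] fun x => r * f x + s * g x := by
  filter_upwards [Lp.coeFn_add (r • f) (s • g), Lp.coeFn_smul r f, Lp.coeFn_smul s g]
    with x hadd hf hg
  rw [hadd, Pi.add_apply, hf, hg, Pi.smul_apply, Pi.smul_apply, smul_eq_mul, smul_eq_mul]

theorem convex_Uad (a b : ℝ) : Convex ℝ (Uad Ω a b) := by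
  intro f hf g hg r s hr hs hrs
  change ∀ᵐ x ∂(vol Ω), _ ∈ Set.Icc a b
  filter_upwards [coeFn_smul_add_smul r s f g, hf, hg] with x hx hfx hgx
  rw [hx]
  exact convex_Icc a b hfx hgx hr hs hrs

theorem integrable_abs [IsFiniteMeasure (vol Ω)] (f : L2 Ω) :
    Integrable (fun x => |f x|) (vol Ω) :=
  ((Lp.memLp f).integrable one_le_two).abs

theorem convexOn_normL1 [IsFiniteMeasure (vol Ω)] :
    ConvexOn ℝ Set.univ (normL1 : L2 Ω → ℝ) := by
  refine ⟨convex_univ, fun f _ g _ r s hr hs _ => ?_⟩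
  simp only [normL1, smul_eq_mul, ← integral_const_mul]
  rw [← integral_add ((integrable_abs f).const_mul r) ((integrable_abs g).const_mul s)]
  refine integral_mono_ae (integrable_abs _)
    (((integrable_abs f).const_mul r).add ((integrable_abs g).const_mul s)) ?_
  filter_upwards [coeFn_smul_add_smul r s f g] with x hx
  rw [hx]
  refine (abs_add_le _ _).trans_eq ?_
  rw [abs_mul, abs_mul, abs_of_nonneg hr, abs_of_nonneg hs]

theorem norm_add_smul_sq {H : Type*} [NormedAddCommGroup H] [InnerProductSpace ℝ H]
    (x d : H) (t : ℝ) :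
    ‖x + t • d‖ ^ 2 = ‖x‖ ^ 2 + 2 * t * inner ℝ x d + t ^ 2 * ‖d‖ ^ 2 := by
  rw [norm_add_sq_real, real_inner_smul_right, norm_smul, mul_pow, Real.norm_eq_abs, sq_abs]
  ring

theorem isMinOn_cost_iff [IsFiniteMeasure (vol Ω)] (hα : 0 ≤ α) (hβ : 0 ≤ β)
    {K : Set (H10 Ω × L2 Ω × L2 Ω)} (hK : Convex ℝ K) {y : H10 Ω} {u z : L2 Ω}
    (hyuz : (y, u, z) ∈ K) :
    IsMinOn (cost yd α β) K (y, u, z) ↔ ∀ w ∈ K,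
      0 ≤ inner ℝ (H10.val y - yd) (H10.val w.1 - H10.val y) + α / 2 * inner ℝ u (w.2.1 - u)
        + α / 2 * inner ℝ z (w.2.2 - z) + (β * normL1 w.2.2 - β * normL1 z) := by
  have hconv : ConvexOn ℝ K fun w => β * normL1 w.2.2 :=
    ((convexOn_normL1.comp_linearMap
      (LinearMap.snd ℝ (L2 Ω) (L2 Ω) ∘ₗ LinearMap.snd ℝ (H10 Ω) (L2 Ω × L2 Ω))).subset
        (Set.subset_univ K) hK).smul hβ
  refine isMinOn_add_iff_of_quadratic
    (f := fun w => 1 / 2 * ‖H10.val w.1 - yd‖ ^ 2 + α / 4 * ‖w.2.1‖ ^ 2 + α / 4 * ‖w.2.2‖ ^ 2)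
    (Q := fun w => 1 / 2 * ‖H10.val w.1 - H10.val y‖ ^ 2 + α / 4 * ‖w.2.1 - u‖ ^ 2
      + α / 4 * ‖w.2.2 - z‖ ^ 2) hyuz hconv (fun w _ => by positivity) fun w _ t => ?_
  have hval : H10.val (y + t • (w.1 - y)) - yd
      = (H10.val y - yd) + t • (H10.val w.1 - H10.val y) := add_sub_right_comm _ _ _
  change 1 / 2 * ‖H10.val (y + t • (w.1 - y)) - yd‖ ^ 2 + α / 4 * ‖u + t • (w.2.1 - u)‖ ^ 2
    + α / 4 * ‖z + t • (w.2.2 - z)‖ ^ 2 = _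
  rw [hval, norm_add_smul_sq, norm_add_smul_sq, norm_add_smul_sq]
  ring

theorem variational_of_ae [IsFiniteMeasure (vol Ω)] {p u w : L2 Ω}
    (h : ∀ᵐ x ∂(vol Ω), 0 ≤ (α * w x - p x) * (u x - w x) + (β * |u x| - β * |w x|)) :
    0 ≤ inner ℝ (α • w - p) (u - w) + β * (normL1 u - normL1 w) := by
  have hgrad : ⇑(α • w - p) =ᵐ[vol Ω] fun x => α * w x - p x := by
    filter_upwards [Lp.coeFn_sub (α • w) p, Lp.coeFn_smul α w] with x hsub hsmul
    rw [hsub, Pi.sub_apply, hsmul, Pi.smul_apply, smul_eq_mul]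
  have hint : Integrable (fun x => (α * w x - p x) * (u x - w x)) (vol Ω) :=
    integrable_mul_of_memLp (((Lp.memLp w).const_mul α).sub (Lp.memLp p))
      ((Lp.memLp u).sub (Lp.memLp w))
  have hdir : ⇑(u - w) =ᵐ[vol Ω] fun x => u x - w x := Lp.coeFn_sub u w
  have hu := (integrable_abs u).const_mul β
  have hw := (integrable_abs w).const_mul β
  have huw : Integrable (fun x => β * |u x| - β * |w x|) (vol Ω) := hu.sub hw
  rw [inner_eq_integral_of_ae_eq hgrad hdir, mul_sub, normL1, normL1, ← integral_const_mul,
    ← integral_const_mul, ← integral_sub hu hw, ← integral_add hint huw]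
  exact integral_nonneg_of_ae h

end ReducedCost

section OptimalitySystem

variable {n : ℕ} {Ω : Opens (EuclideanSpace ℝ (Fin n))}
  {A : EuclideanSpace ℝ (Fin n) → Matrix (Fin n) (Fin n) ℝ} {c₀ : EuclideanSpace ℝ (Fin n) → ℝ}

theorem IsWeakSolution.smul_add_smul (hA : ∀ i j, MemLp (fun x => A x i j) ∞ (vol Ω))
    (hc₀ : MemLp c₀ ∞ (vol Ω)) {y y' : H10 Ω} {f f' : L2 Ω} (h : IsWeakSolution A c₀ y f)
    (h' : IsWeakSolution A c₀ y' f') (r s : ℝ) :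
    IsWeakSolution A c₀ (r • y + s • y') (r • f + s • f') := by
  intro v
  rw [← bilinFormCLM_apply hA hc₀, map_add, map_smul, map_smul, add_apply, smul_apply, smul_apply,
    bilinFormCLM_apply, bilinFormCLM_apply, h v, h' v, inner_add_left, real_inner_smul_left,
    real_inner_smul_left, smul_eq_mul, smul_eq_mul]

theorem convex_feasible (hA : ∀ i j, MemLp (fun x => A x i j) ∞ (vol Ω))
    (hc₀ : MemLp c₀ ∞ (vol Ω)) (yc : L2 Ω) (a b : ℝ) : Convex ℝ (feasible A c₀ yc a b) := by
  rintro ⟨y, u, z⟩ ⟨hy, hu, hz⟩ ⟨y', u', z'⟩ ⟨hy', hu', hz'⟩ r s hr hs hrs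
  refine ⟨?_, congrArg₂ (r • · + s • ·) hu hu', convex_Uad a b hz hz' hr hs hrs⟩
  have hsource : r • (u + yc) + s • (u' + yc) = r • u + s • u' + yc := by
    rw [smul_add, smul_add, add_add_add_comm, ← add_smul, hrs, one_smul]
  exact hsource ▸ hy.smul_add_smul hA hc₀ hy' r s

theorem IsAdjointSolution.inner_sub_eq {y y' p : H10 Ω} {f f' g : L2 Ω}
    (hp : IsAdjointSolution A c₀ p g) (h : IsWeakSolution A c₀ y f)
    (h' : IsWeakSolution A c₀ y' f') :
    inner ℝ g (H10.val y' - H10.val y) = inner ℝ (f' - f) (H10.val p) := by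
  rw [inner_sub_right, ← hp y', ← hp y, h' p, h p, inner_sub_left]

variable {yc yd : L2 Ω} {a b α β : ℝ} {y p : H10 Ω} {u z lam : L2 Ω}

theorem IsAdjointSolution.inner_reducedGradient (hp : IsAdjointSolution A c₀ p (yd - H10.val y))
    (hy : IsWeakSolution A c₀ y (u + yc)) {y' : H10 Ω} {u' : L2 Ω}
    (hy' : IsWeakSolution A c₀ y' (u' + yc)) :
    inner ℝ (H10.val y - yd) (H10.val y' - H10.val y) + α / 2 * inner ℝ u (u' - u)
      + α / 2 * inner ℝ u (u' - u) = inner ℝ (α • u - H10.val p) (u' - u) := by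
  have hdual := hp.inner_sub_eq hy hy'
  rw [add_sub_add_right_eq_sub, ← neg_sub (H10.val y), inner_neg_left,
    real_inner_comm (H10.val p)] at hdual
  rw [inner_sub_left (α • u), real_inner_smul_left]
  linarith

theorem isOptimal_iff_variational [IsFiniteMeasure (vol Ω)]
    {hA : ∀ i j, MemLp (fun x => A x i j) ∞ (vol Ω)} {hc₀ : MemLp c₀ ∞ (vol Ω)}
    (hB : IsCoercive (bilinFormCLM hA hc₀)) (hα : 0 ≤ α) (hβ : 0 ≤ β)
    (hp : IsAdjointSolution A c₀ p (yd - H10.val y)) :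
    IsOptimal A c₀ yc yd a b α β y u z ↔ (y, u, z) ∈ feasible A c₀ yc a b ∧ ∀ zt ∈ Uad Ω a b,
      0 ≤ inner ℝ (α • u - H10.val p) (zt - u) + β * (normL1 zt - normL1 u) := by
  refine and_congr_right fun hfeas => ?_
  rw [isMinOn_cost_iff hα hβ (convex_feasible hA hc₀ yc a b) hfeas]
  obtain ⟨hy, hu, -⟩ := hfeas
  obtain rfl : u = z := hu
  refine ⟨fun h zt hzt => ?_, ?_⟩
  · obtain ⟨yt, hyt⟩ := exists_isWeakSolution hB (zt + yc)
    rw [← hp.inner_reducedGradient hy hyt, mul_sub]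
    exact h (yt, zt, zt) ⟨hyt, rfl, hzt⟩
  · rintro h ⟨y', u', z'⟩ ⟨hy', hu', hz'⟩
    obtain rfl : u' = z' := hu'
    rw [hp.inner_reducedGradient hy hy', ← mul_sub]
    exact h u' hz'

theorem kkt_iff : KKT A c₀ yc yd a b α β y u z p lam ↔
    (y, u, z) ∈ feasible A c₀ yc a b ∧ IsAdjointSolution A c₀ p (yd - H10.val y) ∧
      lam = H10.val p - (α / 2) • u ∧ ∀ zt ∈ Uad Ω a b,
        0 ≤ inner ℝ (α • u - H10.val p) (zt - u) + β * (normL1 zt - normL1 u) := by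
  have hgrad : (α / 2) • u - (H10.val p - (α / 2) • u) = α • u - H10.val p := by module
  constructor
  · rintro ⟨hy, hp, hstat, rfl, hz, hvar⟩
    obtain rfl : lam = H10.val p - (α / 2) • u := by
      rw [← sub_eq_zero, ← hstat]
      abel
    exact ⟨⟨hy, rfl, hz⟩, hp, rfl, hgrad ▸ hvar⟩
  · rintro ⟨⟨hy, hu, hz⟩, hp, rfl, hvar⟩
    obtain rfl : u = z := hu
    exact ⟨hy, hp, by abel, rfl, hz, hgrad.symm ▸ hvar⟩

theorem isOptimal_iff_exists_kkt [IsFiniteMeasure (vol Ω)]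
    {hA : ∀ i j, MemLp (fun x => A x i j) ∞ (vol Ω)} {hc₀ : MemLp c₀ ∞ (vol Ω)}
    (hB : IsCoercive (bilinFormCLM hA hc₀)) (hα : 0 ≤ α) (hβ : 0 ≤ β) :
    IsOptimal A c₀ yc yd a b α β y u z ↔ ∃ p lam, KKT A c₀ yc yd a b α β y u z p lam := by
  refine ⟨fun h => ?_, fun ⟨p, lam, h⟩ => ?_⟩
  · obtain ⟨p, hp⟩ := exists_isAdjointSolution hB (yd - H10.val y)
    obtain ⟨hfeas, hvar⟩ := (isOptimal_iff_variational hB hα hβ hp).1 h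
    exact ⟨p, _, kkt_iff.2 ⟨hfeas, hp, rfl, hvar⟩⟩
  · obtain ⟨hfeas, hp, -, hvar⟩ := kkt_iff.1 h
    exact (isOptimal_iff_variational hB hα hβ hp).2 ⟨hfeas, hvar⟩

theorem KKT.control_eq_lipschitzComp [IsFiniteMeasure (vol Ω)] (hα : 0 < α) (hβ : 0 ≤ β)
    (h : KKT A c₀ yc yd a b α β y u z p lam) {L : NNReal}
    (hL : LipschitzWith L fun t => proj a b (1 / α * soft t β)) :
    u = lipschitzComp hL (H10.val p) := by
  obtain ⟨⟨-, hu, hz⟩, -, -, hvar⟩ := kkt_iff.1 h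
  obtain rfl : u = z := hu
  have hcomp := coeFn_lipschitzComp hL (H10.val p)
  have hmem : lipschitzComp hL (H10.val p) ∈ Uad Ω a b := by
    filter_upwards [hz, hcomp] with x hux hx
    rw [hx]
    exact proj_mem_Icc (hux.1.trans hux.2) _
  refine eq_of_variational hα (hvar _ hmem) ?_
  rw [sub_eq_add_neg, ← mul_neg, neg_sub]
  refine variational_of_ae ?_
  filter_upwards [hz, hcomp] with x hux hx
  rw [hx]
  exact proj_soft_variational hα hβ _ hux

end OptimalitySystem

end SparseControl

end

theorem theorem2p2_general {n : ℕ} {Ω : TopologicalSpace.Opens (EuclideanSpace ℝ (Fin n))}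
    (hΩ : MeasureTheory.volume (Ω : Set (EuclideanSpace ℝ (Fin n))) < ⊤)
    {A : EuclideanSpace ℝ (Fin n) → Matrix (Fin n) (Fin n) ℝ}
    {c₀ : EuclideanSpace ℝ (Fin n) → ℝ}
    {hA : ∀ i j, MeasureTheory.MemLp (fun x => A x i j) ⊤ (SparseControl.vol Ω)}
    {hc₀ : MeasureTheory.MemLp c₀ ⊤ (SparseControl.vol Ω)}
    (hB : IsCoercive (SparseControl.bilinFormCLM hA hc₀))
    (yc yd : SparseControl.L2 Ω) (a b : ℝ) {α β : ℝ} (hα : 0 < α) (hβ : 0 ≤ β)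
    (y : SparseControl.H10 Ω) (u z : SparseControl.L2 Ω) :
    (SparseControl.IsOptimal A c₀ yc yd a b α β y u z ↔
      ∃ (p : SparseControl.H10 Ω) (lam : SparseControl.L2 Ω),
        SparseControl.KKT A c₀ yc yd a b α β y u z p lam) ∧
    (∀ (p : SparseControl.H10 Ω) (lam : SparseControl.L2 Ω),
      SparseControl.KKT A c₀ yc yd a b α β y u z p lam →
        ∀ᵐ x ∂(SparseControl.vol Ω), u x =
          SparseControl.proj a b (1 / α * SparseControl.soft (SparseControl.H10.val p x) β)) ∧
    (SparseControl.IsOptimal A c₀ yc yd a b α β y u z → SparseControl.MemH1 u) := by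
  have : MeasureTheory.IsFiniteMeasure (SparseControl.vol Ω) :=
    MeasureTheory.isFiniteMeasure_restrict.2 hΩ.ne
  obtain ⟨L, hL⟩ := SparseControl.exists_lipschitzWith_proj_soft a b α hβ
  have hiff := SparseControl.isOptimal_iff_exists_kkt (yc := yc) (yd := yd) (a := a) (b := b)
    (y := y) (u := u) (z := z) hB hα.le hβ
  refine ⟨hiff, fun p lam hK => ?_, fun hopt => ?_⟩
  · rw [hK.control_eq_lipschitzComp hα hβ hL]
    exact SparseControl.coeFn_lipschitzComp hL (SparseControl.H10.val p)
  · obtain ⟨p, lam, hK⟩ := hiff.1 hopt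
    rw [hK.control_eq_lipschitzComp hα hβ hL]
    exact SparseControl.memH1_lipschitzComp hL p

theorem theorem2p2 {n : ℕ} (hn : 0 < n)
    (Ω : TopologicalSpace.Opens (EuclideanSpace ℝ (Fin n)))
    (hΩ : Bornology.IsBounded (Ω : Set (EuclideanSpace ℝ (Fin n))))
    (A : EuclideanSpace ℝ (Fin n) → Matrix (Fin n) (Fin n) ℝ)
    (c₀ : EuclideanSpace ℝ (Fin n) → ℝ)
    (hA : SparseControl.UniformlyElliptic Ω A c₀)
    (yc yd : SparseControl.L2 Ω) (a b α β : ℝ)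
    (ha : a < 0) (hb : 0 < b) (hα : 0 < α) (hβ : 0 < β)
    (y : SparseControl.H10 Ω) (u z : SparseControl.L2 Ω) :
    (SparseControl.IsOptimal A c₀ yc yd a b α β y u z ↔
      ∃ (p : SparseControl.H10 Ω) (lam : SparseControl.L2 Ω),
        SparseControl.KKT A c₀ yc yd a b α β y u z p lam) ∧
    (∀ (p : SparseControl.H10 Ω) (lam : SparseControl.L2 Ω),
      SparseControl.KKT A c₀ yc yd a b α β y u z p lam →
        ∀ᵐ x ∂(SparseControl.vol Ω), u x =
          SparseControl.proj a b (1 / α * SparseControl.soft (SparseControl.H10.val p x) β)) ∧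
    (SparseControl.IsOptimal A c₀ yc yd a b α β y u z → SparseControl.MemH1 u) :=
  theorem2p2_general hΩ.measure_lt_top (hA.isCoercive hn hΩ) yc yd a b hα hβ.le y u z
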